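/- Let $\mathcal{A}$ be an associative algebra over $\mathbb{C}$ (not necessarily unital), let $\sigma$ be an automorphism of $\mathcal{A}$, and let $(\mathcal{A},\mathfrak{H},D)$ be a graded $\sigma$-spectral triple. That is: $\mathcal{A}$ is represented by bounded operators on a complex Hilbert space $\mathfrak{H}$; $D$ is a (possibly unbounded) self-adjoint operator in $\mathfrak{H}$ with compact resolvent, whose domain is preserved by $\mathcal{A}$; for every $a\in\mathcal{A}$ the operator $Da-\sigma(a)D$ is bounded on $\operatorname{Dom} D$, and $d_\sigma a$ denotes its extension to a bounded operator on $\mathfrak{H}$; and there is a bounded operator $\gamma=\gamma^*$ with $\gamma^2=1$ which commutes with the action of $\mathcal{A}$, preserves $\operatorname{Dom} D$ and satisfies $D\gamma=-\gamma D$. Let $n\ge 2$ be an even integer. Assume that $D$ is invertible with bounded inverse and that $D^{-1}\in\mathcal{L}^{n,\infty}$, i.e. $D^{-1}$ is compact and its characteristic values satisfy $\mu_k(D^{-1})=O(k^{-1/n})$ as $k\to\infty$. Then for all $a^0,\dots,a^n\in\mathcal{A}$ the operator $\gamma D^{-1}(d_\sigma a^0)\,D^{-1}(d_\sigma a^1)\cdots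 D^{-1}(d_\sigma a^n)$ is trace class, and $$\Phi_{D,\sigma}(a^0,a^1,\dots,a^n):=\operatorname{Tr}\bigl(\gamma D^{-1}(d_\sigma a^0)\,D^{-1}(d_\sigma a^1)\cdots D^{-1}(d_\sigma a^n)\bigr)$$ is a cyclic cocycle in $Z^n_\lambda(\mathcal{A})$, i.e. $\Phi_{D,\sigma}$ is an $(n+1)$-linear form on $\mathcal{A}$ such that, for all $a^0,\dots,a^{n+1}\in\mathcal{A}$, $$\Phi_{D,\sigma}(a^1,\dots,a^n,a^0)=(-1)^n\,\Phi_{D,\sigma}(a^0,a^1,\dots,a^n),$$ $$\sum_{i=0}^{n}(-1)^i\,\Phi_{D,\sigma}(a^0,\dots,a^ia^{i+1},\dots,a^{n+1})+(-1)^{n+1}\,\Phi_{D,\sigma}(a^{n+1}a^0,a^1,\dots,a^n)=0 .$$ -/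

import Mathlib

open scoped InnerProductSpace

noncomputable section

namespace NCG

/-! ### Characteristic values, Schatten-type ideals and the operator trace -/

section Ideals

variable {H : Type*} [NormedAddCommGroup H] [InnerProductSpace ℂ H]

/-- The `k`-th characteristic value `μ_k(T)`, `k = 0, 1, 2, …`, of a bounded operator: its distance
in operator norm to the operators of rank at most `k`. -/
def charValue (k : ℕ) (T : H →L[ℂ] H) : ℝ :=
  ⨅ R : {R : H →L[ℂ] H // LinearMap.rank (R : H →ₗ[ℂ] H) ≤ (k : Cardinal)}, ‖T - R.1‖

/-- Membership in the weak Schatten ideal `𝓛^{p,∞}`, `p > 1`: the compact operators `T` with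
`μ_k(T) = O(k^{-1/p})`. -/
def MemWeakSchatten (p : ℝ) (T : H →L[ℂ] H) : Prop :=
  IsCompactOperator T ∧
    (fun k : ℕ => charValue k T) =O[Filter.atTop] fun k : ℕ => (k : ℝ) ^ (-(1 / p))

/-- Trace class operators: the compact operators with summable characteristic values. -/
def IsTraceClass (T : H →L[ℂ] H) : Prop :=
  IsCompactOperator T ∧ Summable fun k : ℕ => charValue k T

end Ideals

/-- `HasTrace T t`: the operator `T` is trace class and its trace is `t`, that is
`∑ i, ⟪e i, T (e i)⟫ = t` (absolutely convergent) for every Hilbert basis `e`. -/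
def HasTrace {H : Type*} [NormedAddCommGroup H] [InnerProductSpace ℂ H]
    (T : H →L[ℂ] H) (t : ℂ) : Prop :=
  IsTraceClass T ∧
    ∀ (s : Set H) (e : HilbertBasis s ℂ H), HasSum (fun i => ⟪e i, T (e i)⟫_ℂ) t

/-- The trace of an operator is uniquely determined. -/
theorem HasTrace.unique {H : Type*} [NormedAddCommGroup H] [InnerProductSpace ℂ H]
    [CompleteSpace H] {T : H →L[ℂ] H} {t t' : ℂ} (h : HasTrace T t) (h' : HasTrace T t') :
    t = t' := by
  obtain ⟨s, e, -⟩ := exists_hilbertBasis ℂ H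
  exact (h.2 s e).unique (h'.2 s e)

/-! ### Unbounded operators -/

section Unbounded

variable {H : Type*} [NormedAddCommGroup H] [InnerProductSpace ℂ H]

/-- `R` is the resolvent `(D - z)⁻¹`: a bounded operator, defined on the whole space, with values
in the domain of `D`, which is a two-sided inverse of `D - z : dom D → H`. -/
def IsResolventAt (D : H →ₗ.[ℂ] H) (z : ℂ) (R : H →L[ℂ] H) : Prop :=
  (∀ y : H, ∃ h : R y ∈ D.domain, D ⟨R y, h⟩ - z • R y = y) ∧
    ∀ x : D.domain, R (D x - z • (x : H)) = x

/-- `D` has compact resolvent: `(D - z)⁻¹` exists and is compact for some `z`. (By the resolvent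
identity it is then compact for every `z` in the resolvent set.) -/
def HasCompactResolvent (D : H →ₗ.[ℂ] H) : Prop :=
  ∃ (z : ℂ) (R : H →L[ℂ] H), IsResolventAt D z R ∧ IsCompactOperator R

/-- `D` is invertible, with bounded inverse: `0` belongs to its resolvent set. -/
def IsInvertible (D : H →ₗ.[ℂ] H) : Prop :=
  ∃ R : H →L[ℂ] H, IsResolventAt D 0 R

/-- The bounded inverse `D⁻¹` of an invertible operator. -/
def boundedInverse (D : H →ₗ.[ℂ] H) (hD : IsInvertible D) : H →L[ℂ] H :=
  hD.choose

theorem boundedInverse_spec (D : H →ₗ.[ℂ] H) (hD : IsInvertible D) :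
    IsResolventAt D 0 (boundedInverse D hD) :=
  hD.choose_spec

end Unbounded

/-! ### Twisted spectral triples -/

section Triples

variable {A : Type*} [NonUnitalRing A] [Module ℂ A]

/-- A (not necessarily graded) `σ`-spectral triple over the complex algebra `A`, where `σ` is an
automorphism of `A`. The algebra acts by bounded operators preserving the domain of `D`. -/
structure TwistedSpectralTriple (σ : A →ₙₐ[ℂ] A) (H : Type*) [NormedAddCommGroup H]
    [InnerProductSpace ℂ H] [CompleteSpace H] where
  /-- the action of the algebra -/
  rep : A →ₙₐ[ℂ] (H →L[ℂ] H)
  /-- the unbounded operator `D` -/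
  D : H →ₗ.[ℂ] H
  isSelfAdjoint_D : IsSelfAdjoint D
  hasCompactResolvent_D : HasCompactResolvent D
  rep_mem_domain : ∀ (a : A) (x : D.domain), rep a x ∈ D.domain
  /-- `D a - σ(a) D`, defined on the domain of `D`, is bounded -/
  bounded_commutator : ∀ a : A, ∃ C : ℝ, ∀ x : D.domain,
    ‖D ⟨rep a x, rep_mem_domain a x⟩ - rep (σ a) (D x)‖ ≤ C * ‖(x : H)‖

namespace TwistedSpectralTriple

variable {σ : A →ₙₐ[ℂ] A} {H : Type*} [NormedAddCommGroup H] [InnerProductSpace ℂ H]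
  [CompleteSpace H]

/-- The twisted commutator `D a - σ(a) D` as an operator defined on the domain of `D`. -/
def commutatorOnDomain (𝒯 : TwistedSpectralTriple σ H) (a : A) : 𝒯.D.domain →ₗ[ℂ] H :=
  𝒯.D.toFun ∘ₗ
      ((𝒯.rep a : H →ₗ[ℂ] H).restrict fun x hx => 𝒯.rep_mem_domain a ⟨x, hx⟩) -
    (𝒯.rep (σ a) : H →ₗ[ℂ] H) ∘ₗ 𝒯.D.toFun

/-- `d_σ a`: the continuous extension to `H` of the twisted commutator `D a - σ(a) D`. -/
def dσ (𝒯 : TwistedSpectralTriple σ H) (a : A) : H →L[ℂ] H :=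
  (𝒯.commutatorOnDomain a).extendOfNorm 𝒯.D.domain.subtype

theorem dσ_apply (𝒯 : TwistedSpectralTriple σ H) (a : A) (x : 𝒯.D.domain) :
    𝒯.dσ a x = 𝒯.D ⟨𝒯.rep a x, 𝒯.rep_mem_domain a x⟩ - 𝒯.rep (σ a) (𝒯.D x) := by
  have hd : DenseRange 𝒯.D.domain.subtype := by
    simpa [DenseRange] using 𝒯.isSelfAdjoint_D.dense_domain
  exact LinearMap.extendOfNorm_eq (f := 𝒯.commutatorOnDomain a) (e := 𝒯.D.domain.subtype)
    hd (𝒯.bounded_commutator a) x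

end TwistedSpectralTriple

/-- A graded `σ`-spectral triple: in addition there is a self-adjoint involution `γ` that commutes
with the algebra and anticommutes with `D` (in particular it preserves the domain of `D`). -/
structure GradedTwistedSpectralTriple (σ : A →ₙₐ[ℂ] A) (H : Type*) [NormedAddCommGroup H]
    [InnerProductSpace ℂ H] [CompleteSpace H] extends TwistedSpectralTriple σ H where
  /-- the grading operator -/
  γ : H →L[ℂ] H
  isSelfAdjoint_γ : IsSelfAdjoint γ
  γ_mul_γ : γ * γ = 1
  γ_comm_rep : ∀ a : A, γ * rep a = rep a * γ
  γ_mem_domain : ∀ x : D.domain, γ x ∈ D.domain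
  D_γ : ∀ x : D.domain, D ⟨γ x, γ_mem_domain x⟩ = -γ (D x)

/-- The bounded operator `γ D⁻¹ (d_σ a⁰) D⁻¹ (d_σ a¹) ⋯ D⁻¹ (d_σ aⁿ)`. -/
def GradedTwistedSpectralTriple.chernOperator {σ : A →ₙₐ[ℂ] A} {H : Type*}
    [NormedAddCommGroup H] [InnerProductSpace ℂ H] [CompleteSpace H]
    (𝒯 : GradedTwistedSpectralTriple σ H) (hD : IsInvertible 𝒯.D) {n : ℕ}
    (a : Fin (n + 1) → A) : H →L[ℂ] H :=
  𝒯.γ * (List.ofFn fun i => boundedInverse 𝒯.D hD * 𝒯.dσ (a i)).prod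

end Triples

/-! ### Cyclic cocycles -/

section Cyclic

variable (A : Type*) [NonUnitalRing A] [Module ℂ A]

/-- Hochschild `n`-cochains: the `(n+1)`-linear forms on `A`. -/
abbrev Cochain (n : ℕ) : Type _ :=
  MultilinearMap ℂ (fun _ : Fin (n + 1) => A) ℂ

variable {A}

/-- The Hochschild coboundary
`(b φ)(a⁰, …, aⁿ⁺¹) = ∑_{i=0}^{n} (-1)^i φ(a⁰, …, aⁱaⁱ⁺¹, …, aⁿ⁺¹)
  + (-1)^{n+1} φ(aⁿ⁺¹a⁰, a¹, …, aⁿ)`. -/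
def hochschildB {n : ℕ} (φ : Cochain A n) (a : Fin (n + 2) → A) : ℂ :=
  (∑ i : Fin (n + 1), (-1) ^ (i : ℕ) * φ (Fin.contractNth i.castSucc (· * ·) a)) +
    (-1) ^ (n + 1) *
      φ (Fin.cons (a (Fin.last (n + 1)) * a 0) fun i : Fin n => a i.succ.castSucc)

variable (A)

/-- The space `Z^n_λ(A)` of cyclic `n`-cocycles: the `(n+1)`-linear forms `φ` with
`φ(a¹, …, aⁿ, a⁰) = (-1)^n φ(a⁰, …, aⁿ)` and `b φ = 0`. -/
def cyclicCocycles (n : ℕ) : Submodule ℂ (Cochain A n) where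
  carrier := {φ | (∀ a : Fin (n + 1) → A, φ (fun i => a (i + 1)) = (-1) ^ n * φ a) ∧
    ∀ a : Fin (n + 2) → A, hochschildB φ a = 0}
  zero_mem' := by simp [hochschildB]
  add_mem' := by
    rintro φ ψ ⟨hφ, hφ'⟩ ⟨hψ, hψ'⟩
    refine ⟨fun a => ?_, fun a => ?_⟩
    · simp only [add_apply, hφ, hψ, mul_add]
    · have h := congrArg₂ (· + ·) (hφ' a) (hψ' a)
      simp only [hochschildB, add_zero] at h
      simp only [hochschildB, add_apply, mul_add, Finset.sum_add_distrib]
      linear_combination h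
  smul_mem' := by
    rintro c φ ⟨hφ, hφ'⟩
    refine ⟨fun a => ?_, fun a => ?_⟩
    · simp only [smul_apply, hφ, smul_eq_mul]
      ring
    · have h := congrArg (c * ·) (hφ' a)
      simp only [hochschildB, mul_zero, mul_add, Finset.mul_sum] at h
      simp only [hochschildB, smul_apply, smul_eq_mul, mul_left_comm _ c]
      exact h

end Cyclic

end NCG

end

/-! Write π for the action and α(a) for the bounded extension of D⁻¹σ(a)D, so that D⁻¹ d_σ a = π(a)
− α(a). Both π and α are multiplicative and commute with γ, since γ anticommutes with D and with
D⁻¹. The twist thus disappears: the form is built from two homomorphisms whose difference lies in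
𝓛^{n,∞}. The alternating sum of products telescopes (`sum_prod_contractNth`); for even n, the two
operators that remain are cancelled, under the trace, by the last Hochschild term. Cyclicity moves a
single factor past the others.

The analytic difficulty is Tr(ST) = Tr(TS) when S is one factor and T contains the other n: T is
only of weak type 𝓛^{1,∞} and need not be trace class. Decay is therefore recorded by approximants
of rank 2^j with error O(x^j), x = 2^(-1/n), and these rates multiply under products
(`DyadicApprox.mul`). Expanding S and T into finite rank pieces makes each commutation elementary,
and the double series of diagonal sums converges absolutely because min(2^j, 2^l) ≤ s^j (2/s)^l for
1 ≤ s ≤ 2 (`DyadicApprox.exists_hasDiagSum_mul_comm'`). -/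

namespace NCG

/-! ### Diagonal sums of bounded operators -/

section DiagonalSums

variable {H : Type*} [NormedAddCommGroup H] [InnerProductSpace ℂ H]

/-- The diagonal of `T` is summable with sum `t` in every Hilbert basis. -/
def HasDiagSum (T : H →L[ℂ] H) (t : ℂ) : Prop :=
  ∀ (s : Set H) (e : HilbertBasis s ℂ H), HasSum (fun i => ⟪e i, T (e i)⟫_ℂ) t

/-- The finite absolute diagonal sums of `T` are at most `c` in every Hilbert basis. -/
def DiagLE (T : H →L[ℂ] H) (c : ℝ) : Prop :=
  ∀ (s : Set H) (e : HilbertBasis s ℂ H) (F : Finset s), ∑ i ∈ F, ‖⟪e i, T (e i)⟫_ℂ‖ ≤ c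

theorem HasDiagSum.unique [CompleteSpace H] {T : H →L[ℂ] H} {t t' : ℂ} (h : HasDiagSum T t)
    (h' : HasDiagSum T t') : t = t' := by
  obtain ⟨s, e, -⟩ := exists_hilbertBasis ℂ H
  exact (h s e).unique (h' s e)

theorem HasDiagSum.add {S T : H →L[ℂ] H} {s t : ℂ} (hS : HasDiagSum S s) (hT : HasDiagSum T t) :
    HasDiagSum (S + T) (s + t) := fun u e => by
  simpa [inner_add_right] using (hS u e).add (hT u e)

theorem HasDiagSum.smul {T : H →L[ℂ] H} {t : ℂ} (c : ℂ) (hT : HasDiagSum T t) :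
    HasDiagSum (c • T) (c * t) := fun u e => by
  simpa [inner_smul_right] using (hT u e).mul_left c

theorem HasDiagSum.sum {ι : Type*} (F : Finset ι) {T : ι → H →L[ℂ] H} {t : ι → ℂ}
    (h : ∀ i ∈ F, HasDiagSum (T i) (t i)) : HasDiagSum (∑ i ∈ F, T i) (∑ i ∈ F, t i) := fun u e => by
  simpa [inner_sum, sum_apply] using hasSum_sum fun i hi => h i hi u e

theorem DiagLE.sum {ι : Type*} (F : Finset ι) {T : ι → H →L[ℂ] H} {c : ι → ℝ}
    (h : ∀ i ∈ F, DiagLE (T i) (c i)) : DiagLE (∑ i ∈ F, T i) (∑ i ∈ F, c i) := fun u e G => by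
  simp only [sum_apply, inner_sum]
  calc _ ≤ ∑ j ∈ G, ∑ i ∈ F, ‖⟪e j, T i (e j)⟫_ℂ‖ := Finset.sum_le_sum fun j _ => norm_sum_le _ _
    _ = ∑ i ∈ F, ∑ j ∈ G, ‖⟪e j, T i (e j)⟫_ℂ‖ := Finset.sum_comm
    _ ≤ _ := Finset.sum_le_sum fun i hi => h i hi u e G

theorem DiagLE.mono {T : H →L[ℂ] H} {c c' : ℝ} (h : DiagLE T c) (hc : c ≤ c') : DiagLE T c' :=
  fun u e G => (h u e G).trans hc

theorem hasDiagSum_of_rankOne {T : H →L[ℂ] H} {x y : H} (hT : ∀ v, T v = ⟪y, v⟫_ℂ • x) :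
    HasDiagSum T ⟪y, x⟫_ℂ := fun u e => by
  simpa [hT, inner_smul_right] using e.hasSum_inner_mul_inner y x

/-- Cauchy–Schwarz followed by Bessel; the bound does not depend on the basis. -/
theorem diagLE_of_rankOne {T : H →L[ℂ] H} {x y : H} (hT : ∀ v, T v = ⟪y, v⟫_ℂ • x) :
    DiagLE T (‖y‖ * ‖x‖) := fun u e G => by
  have hy : √(∑ i ∈ G, ‖⟪e i, y⟫_ℂ‖ ^ 2) ≤ ‖y‖ :=
    Real.sqrt_le_iff.2 ⟨norm_nonneg _, e.orthonormal.sum_inner_products_le y⟩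
  have hx : √(∑ i ∈ G, ‖⟪e i, x⟫_ℂ‖ ^ 2) ≤ ‖x‖ :=
    Real.sqrt_le_iff.2 ⟨norm_nonneg _, e.orthonormal.sum_inner_products_le x⟩
  calc ∑ i ∈ G, ‖⟪e i, T (e i)⟫_ℂ‖ = ∑ i ∈ G, ‖⟪e i, y⟫_ℂ‖ * ‖⟪e i, x⟫_ℂ‖ :=
        Finset.sum_congr rfl fun i _ => by
          rw [hT, inner_smul_right, norm_mul, norm_inner_symm y]
    _ ≤ _ := Real.sum_mul_le_sqrt_mul_sqrt _ _ _
    _ ≤ _ := by gcongr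

/-- Termwise summation of the diagonal sums of a series of operators. -/
theorem hasDiagSum_tsum {κ : Type*} {T : κ → H →L[ℂ] H} {S : H →L[ℂ] H} {t : κ → ℂ} {c : κ → ℝ}
    (hS : HasSum T S) (ht : ∀ k, HasDiagSum (T k) (t k)) (hc : ∀ k, DiagLE (T k) (c k))
    (hsum : Summable c) : HasDiagSum S (∑' k, t k) := fun u e => by
  classical
  have hc0 : ∀ k, 0 ≤ c k := fun k => by simpa using hc k u e ∅
  -- Absolute summability over pairs (basis vector, term) allows summing in either order: one gives
  -- the diagonal of `S`, the other gives `∑' k, t k`.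
  have hf : Summable fun p : u × κ => ⟪e p.1, T p.2 (e p.1)⟫_ℂ := by
    refine Summable.of_norm (summable_of_sum_le (c := ∑' k, c k) (fun _ => norm_nonneg _)
      fun F => ?_)
    calc ∑ p ∈ F, ‖⟪e p.1, T p.2 (e p.1)⟫_ℂ‖
        ≤ ∑ p ∈ F.image Prod.fst ×ˢ F.image Prod.snd, ‖⟪e p.1, T p.2 (e p.1)⟫_ℂ‖ :=
          Finset.sum_le_sum_of_subset_of_nonneg Finset.subset_product fun _ _ _ => norm_nonneg _
      _ = ∑ k ∈ F.image Prod.snd, ∑ i ∈ F.image Prod.fst, ‖⟪e i, T k (e i)⟫_ℂ‖ :=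
          Finset.sum_product_right _ _ _
      _ ≤ ∑ k ∈ F.image Prod.snd, c k := Finset.sum_le_sum fun k _ => hc k u e _
      _ ≤ _ := hsum.sum_le_tsum _ fun k _ => hc0 k
  have h1 := hf.hasSum.prod_fiberwise (g := fun i => ⟪e i, S (e i)⟫_ℂ) fun i =>
    ((innerSL ℂ (e i)).hasSum ((ContinuousLinearMap.apply ℂ H (e i)).hasSum hS))
  have h2 := ((Equiv.prodComm κ u).hasSum_iff.2 hf.hasSum).prod_fiberwise (g := t) fun k =>
    ht k u e
  rw [h2.tsum_eq]
  exact h1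

variable [CompleteSpace H]

/-- For a finite rank operator `S`, the operators `S B` and `B S` have the same diagonal sum, and
their absolute diagonal sums are controlled by the rank of `S`. -/
theorem exists_hasDiagSum_of_rank_le {S : H →L[ℂ] H} {r : ℕ}
    (hr : LinearMap.rank (S : H →ₗ[ℂ] H) ≤ (r : Cardinal)) (B : H →L[ℂ] H) :
    ∃ t, HasDiagSum (S * B) t ∧ HasDiagSum (B * S) t ∧ DiagLE (S * B) (r * (‖S‖ * ‖B‖)) ∧
      DiagLE (B * S) (r * (‖S‖ * ‖B‖)) := by
  let V := LinearMap.range (S : H →ₗ[ℂ] H)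
  have hlt : Module.rank ℂ V < Cardinal.aleph0 := hr.trans_lt (Cardinal.natCast_lt_aleph0)
  have : FiniteDimensional ℂ V := Module.rank_lt_aleph0_iff.1 hlt
  have hfr : Module.finrank ℂ V ≤ r := by
    have : (Module.finrank ℂ V : Cardinal) ≤ r := by rw [Module.finrank_eq_rank]; exact hr
    exact_mod_cast this
  let u := stdOrthonormalBasis ℂ V
  -- With x an orthonormal basis of the range and y = S*x, `S` is the sum of the rank one operators
  -- v ↦ ⟪y i, v⟫ x i.
  let x : Fin (Module.finrank ℂ V) → H := fun i => (u i : H)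
  let y : Fin (Module.finrank ℂ V) → H := fun i => ContinuousLinearMap.adjoint S (x i)
  have hx : ∀ i, ‖x i‖ = 1 := fun i => u.orthonormal.1 i
  have hy : ∀ i, ‖y i‖ ≤ ‖S‖ := fun i => by
    simpa [hx] using (ContinuousLinearMap.adjoint S).le_opNorm (x i)
  have hS : ∀ v, S v = ∑ i, ⟪y i, v⟫_ℂ • x i := fun v => by
    have := congrArg (Subtype.val) (u.sum_repr' ⟨S v, LinearMap.mem_range_self _ v⟩)
    simp only [Submodule.coe_sum, Submodule.coe_smul, Submodule.coe_inner] at this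
    simp only [y, ContinuousLinearMap.adjoint_inner_left]
    exact this.symm
  let P : Fin (Module.finrank ℂ V) → H →L[ℂ] H := fun i => InnerProductSpace.rankOne ℂ (x i) (y i)
  have hP : ∀ i v, P i v = ⟪y i, v⟫_ℂ • x i := fun i v => by simp [P]
  have hSP : S = ∑ i, P i := by
    ext v; simp [hS, hP]
  have h1 : ∀ i v, (P i * B) v = ⟪ContinuousLinearMap.adjoint B (y i), v⟫_ℂ • x i := fun i v => by
    simp [hP, ContinuousLinearMap.adjoint_inner_left]
  have h2 : ∀ i v, (B * P i) v = ⟪y i, v⟫_ℂ • B (x i) := fun i v => by simp [hP]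
  have hsum : ∑ _i : Fin (Module.finrank ℂ V), ‖S‖ * ‖B‖ ≤ r * (‖S‖ * ‖B‖) := by
    rw [Finset.sum_const, Finset.card_univ, Fintype.card_fin, nsmul_eq_mul]
    gcongr
  -- Moving `B` onto y i by its adjoint, or applying it to x i, gives the same number ⟪y i, B (x
  -- i)⟫.
  refine ⟨∑ i, ⟪y i, B (x i)⟫_ℂ, ?_, ?_, ?_, ?_⟩
  · rw [hSP, Finset.sum_mul]
    refine HasDiagSum.sum _ fun i _ => ?_
    simpa only [ContinuousLinearMap.adjoint_inner_left] using hasDiagSum_of_rankOne (h1 i)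
  · rw [hSP, Finset.mul_sum]
    exact HasDiagSum.sum _ fun i _ => hasDiagSum_of_rankOne (h2 i)
  · refine DiagLE.mono ?_ hsum
    conv in S * B => rw [hSP, Finset.sum_mul]
    refine DiagLE.sum _ fun i _ => (diagLE_of_rankOne (h1 i)).mono ?_
    rw [hx, mul_one, mul_comm]
    refine ((ContinuousLinearMap.adjoint B).le_opNorm _).trans ?_
    rw [LinearIsometryEquiv.norm_map]
    gcongr
    exact hy i
  · refine DiagLE.mono ?_ hsum
    conv in B * S => rw [hSP, Finset.mul_sum]
    refine DiagLE.sum _ fun i _ => (diagLE_of_rankOne (h2 i)).mono ?_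
    gcongr
    · exact hy i
    · simpa [hx] using B.le_opNorm (x i)

end DiagonalSums

/-! ### Geometric approximation by operators of finite rank -/

section DyadicApprox

variable {H : Type*} [NormedAddCommGroup H] [InnerProductSpace ℂ H]

/-- The distance from `T` to the operators of rank at most `2 ^ j` is `O(x ^ j)`. For
`x = 2 ^ (-1 / p)` this describes the weak Schatten ideal `𝓛^{p,∞}`. -/
def DyadicApprox (x : ℝ) (T : H →L[ℂ] H) : Prop :=
  ∃ C : ℝ, ∀ j : ℕ, ∃ R : H →L[ℂ] H,
    LinearMap.rank (R : H →ₗ[ℂ] H) ≤ ((2 ^ j : ℕ) : Cardinal) ∧ ‖T - R‖ ≤ C * x ^ j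

theorem rank_add_le_natCast {R S : H →L[ℂ] H} {r s : ℕ}
    (hR : LinearMap.rank (R : H →ₗ[ℂ] H) ≤ (r : Cardinal))
    (hS : LinearMap.rank (S : H →ₗ[ℂ] H) ≤ (s : Cardinal)) :
    LinearMap.rank ((R + S : H →L[ℂ] H) : H →ₗ[ℂ] H) ≤ ((r + s : ℕ) : Cardinal) := by
  push_cast
  exact (LinearMap.rank_add_le (R : H →ₗ[ℂ] H) S).trans (add_le_add hR hS)

theorem rank_mul_le_left {R : H →L[ℂ] H} (S : H →L[ℂ] H) :
    LinearMap.rank ((R * S : H →L[ℂ] H) : H →ₗ[ℂ] H) ≤ LinearMap.rank (R : H →ₗ[ℂ] H) :=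
  LinearMap.rank_comp_le_left (S : H →ₗ[ℂ] H) (R : H →ₗ[ℂ] H)

theorem rank_mul_le_right (R : H →L[ℂ] H) {S : H →L[ℂ] H} {s : ℕ}
    (hS : LinearMap.rank (S : H →ₗ[ℂ] H) ≤ (s : Cardinal)) :
    LinearMap.rank ((R * S : H →L[ℂ] H) : H →ₗ[ℂ] H) ≤ (s : Cardinal) :=
  (LinearMap.rank_comp_le_right (S : H →ₗ[ℂ] H) (R : H →ₗ[ℂ] H)).trans hS

theorem rank_neg_eq (R : H →L[ℂ] H) :
    LinearMap.rank ((-R : H →L[ℂ] H) : H →ₗ[ℂ] H) = LinearMap.rank (R : H →ₗ[ℂ] H) := by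
  have : ((-R : H →L[ℂ] H) : H →ₗ[ℂ] H) = -(R : H →ₗ[ℂ] H) := rfl
  rw [LinearMap.rank, LinearMap.rank, this, LinearMap.range_neg]

theorem DyadicApprox.mul_right {x : ℝ} {T : H →L[ℂ] H} (h : DyadicApprox x T) (B : H →L[ℂ] H) :
    DyadicApprox x (T * B) := by
  obtain ⟨C, hC⟩ := h
  refine ⟨C * ‖B‖, fun j => ?_⟩
  obtain ⟨R, hR, hn⟩ := hC j
  refine ⟨R * B, (rank_mul_le_left B).trans hR, ?_⟩
  rw [← sub_mul]
  calc _ ≤ ‖T - R‖ * ‖B‖ := norm_mul_le _ _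
    _ ≤ C * x ^ j * ‖B‖ := by gcongr
    _ = _ := by ring

theorem DyadicApprox.mul_left {x : ℝ} {T : H →L[ℂ] H} (h : DyadicApprox x T) (B : H →L[ℂ] H) :
    DyadicApprox x (B * T) := by
  obtain ⟨C, hC⟩ := h
  refine ⟨‖B‖ * C, fun j => ?_⟩
  obtain ⟨R, hR, hn⟩ := hC j
  refine ⟨B * R, rank_mul_le_right B hR, ?_⟩
  rw [← mul_sub]
  calc _ ≤ ‖B‖ * ‖T - R‖ := norm_mul_le _ _
    _ ≤ ‖B‖ * (C * x ^ j) := by gcongr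
    _ = _ := by ring

theorem dyadicApprox_one (T : H →L[ℂ] H) : DyadicApprox 1 T :=
  ⟨‖T‖, fun j => ⟨0, by simp, by simp⟩⟩

/-- The error factors as ST − (RT + (S − R)R') = (S − R)(T − R'), so the rates multiply. The rank
doubles from 2^j to 2^(j+1); this index shift costs the factor 1/(xy), and index 0 is served by the
zero operator. -/
theorem DyadicApprox.mul {x y : ℝ} {S T : H →L[ℂ] H} (hx : 0 < x) (hy : 0 < y)
    (hS : DyadicApprox x S) (hT : DyadicApprox y T) : DyadicApprox (x * y) (S * T) := by
  obtain ⟨C, hC⟩ := hS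
  obtain ⟨C', hC'⟩ := hT
  refine ⟨max ‖S * T‖ (C * C' / (x * y)), fun j => ?_⟩
  cases j with
  | zero => exact ⟨0, by simp, by simp⟩
  | succ j =>
    obtain ⟨R, hR, hn⟩ := hC j
    obtain ⟨R', hR', hn'⟩ := hC' j
    refine ⟨R * T + (S - R) * R', ?_, ?_⟩
    · rw [pow_succ, mul_two]
      exact rank_add_le_natCast ((rank_mul_le_left T).trans hR) (rank_mul_le_right _ hR')
    · have : S * T - (R * T + (S - R) * R') = (S - R) * (T - R') := by noncomm_ring
      rw [this]
      calc _ ≤ ‖S - R‖ * ‖T - R'‖ := norm_mul_le _ _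
        _ ≤ (C * x ^ j) * (C' * y ^ j) :=
            mul_le_mul hn hn' (norm_nonneg _) ((norm_nonneg _).trans hn)
        _ = C * C' / (x * y) * (x * y) ^ (j + 1) := by rw [pow_succ, mul_pow]; field_simp
        _ ≤ _ := by gcongr; exact le_max_right _ _

theorem DyadicApprox.prod_ofFn {x : ℝ} (hx : 0 < x) {m : ℕ} {T : Fin m → H →L[ℂ] H}
    (h : ∀ i, DyadicApprox x (T i)) : DyadicApprox (x ^ m) (List.ofFn T).prod := by
  induction m with
  | zero => simpa using dyadicApprox_one _
  | succ m ih =>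
    rw [List.ofFn_succ, List.prod_cons, pow_succ']
    exact (h 0).mul hx (pow_pos hx m) (ih fun i => h i.succ)

/-- Decomposition into a geometrically convergent series of operators of dyadic rank. -/
theorem DyadicApprox.exists_hasSum [CompleteSpace H] {x : ℝ} {T : H →L[ℂ] H} (hx : 0 < x)
    (hx1 : x < 1)
    (h : DyadicApprox x T) : ∃ (C : ℝ) (S : ℕ → H →L[ℂ] H), HasSum S T ∧
      (∀ j, LinearMap.rank (S j : H →ₗ[ℂ] H) ≤ ((2 ^ (j + 1) : ℕ) : Cardinal)) ∧
      ∀ j, ‖S j‖ ≤ C * x ^ j := by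
  obtain ⟨C, hC⟩ := h
  choose R hR hn using hC
  have hC0 : 0 ≤ C := by simpa using (norm_nonneg _).trans (hn 0)
  -- Consecutive differences of the approximants, started at `R 0`, so that the partial sums are the
  -- `R j`.
  let S : ℕ → H →L[ℂ] H := fun j => Nat.casesOn j (R 0) fun j => R (j + 1) - R j
  have hSn : ∀ j, ‖S j‖ ≤ (‖R 0‖ + (C + C / x)) * x ^ j := by
    rintro (_ | j)
    · have : 0 ≤ C + C / x := by positivity
      rw [pow_zero, mul_one]
      exact le_add_of_nonneg_right (a := ‖R 0‖) this
    · calc ‖R (j + 1) - R j‖ = ‖(T - R j) - (T - R (j + 1))‖ := by congr 1; abel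
        _ ≤ C * x ^ j + C * x ^ (j + 1) := (norm_sub_le _ _).trans (add_le_add (hn j) (hn (j + 1)))
        _ = (C + C / x) * x ^ (j + 1) := by field_simp; ring
        _ ≤ _ := mul_le_mul_of_nonneg_right (le_add_of_nonneg_left (norm_nonneg _))
            (pow_nonneg hx.le _)
  have hsum : Summable S := Summable.of_norm_bounded
    ((summable_geometric_of_lt_one hx.le hx1).mul_left _) hSn
  refine ⟨_, S, hsum.hasSum_iff_tendsto_nat.2 ?_, ?_, hSn⟩
  · rw [← Filter.tendsto_add_atTop_iff_nat 1]
    have hpart : ∀ j, ∑ i ∈ Finset.range (j + 1), S i = R j := fun j => by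
      induction j with
      | zero => simp [S]
      | succ j ih => rw [Finset.sum_range_succ, ih]; simp [S]
    simp only [hpart]
    rw [tendsto_iff_norm_sub_tendsto_zero]
    refine squeeze_zero (fun _ => norm_nonneg _) (fun j => ?_)
      (by simpa using (tendsto_pow_atTop_nhds_zero_of_lt_one hx.le hx1).const_mul C)
    rw [norm_sub_rev]
    exact hn j
  · rintro (_ | j)
    · exact (hR 0).trans (by exact_mod_cast Nat.pow_le_pow_right two_pos (Nat.zero_le 1))
    · refine le_trans (b := ((2 ^ (j + 1) + 2 ^ j : ℕ) : Cardinal)) ?_ ?_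
      · simp only [S, sub_eq_add_neg]
        exact rank_add_le_natCast (hR (j + 1)) ((rank_neg_eq _).trans_le (hR j))
      · have : 2 ^ (j + 1) + 2 ^ j ≤ 2 ^ (j + 1 + 1) := by
          rw [pow_succ _ (j + 1), mul_two, pow_succ]; omega
        exact_mod_cast this

/-! ### Characteristic values and dyadic rates -/

theorem exists_rank_le_of_charValue_lt {T : H →L[ℂ] H} {k : ℕ} {c : ℝ} (h : charValue k T < c) :
    ∃ R : H →L[ℂ] H, LinearMap.rank (R : H →ₗ[ℂ] H) ≤ (k : Cardinal) ∧ ‖T - R‖ < c := by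
  have : Nonempty {R : H →L[ℂ] H // LinearMap.rank (R : H →ₗ[ℂ] H) ≤ (k : Cardinal)} :=
    ⟨⟨0, by simp⟩⟩
  obtain ⟨R, hR⟩ := exists_lt_of_ciInf_lt h
  exact ⟨R.1, R.2, hR⟩

theorem charValue_le_norm_sub {T R : H →L[ℂ] H} {k : ℕ}
    (hR : LinearMap.rank (R : H →ₗ[ℂ] H) ≤ (k : Cardinal)) : charValue k T ≤ ‖T - R‖ :=
  ciInf_le (f := fun R : {R : H →L[ℂ] H // LinearMap.rank (R : H →ₗ[ℂ] H) ≤ (k : Cardinal)} =>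
    ‖T - R.1‖) ⟨0, by rintro _ ⟨R, rfl⟩; exact norm_nonneg _⟩ ⟨R, hR⟩

theorem charValue_nonneg (k : ℕ) (T : H →L[ℂ] H) : 0 ≤ charValue k T :=
  Real.iInf_nonneg fun _ => norm_nonneg _

theorem charValue_antitone (T : H →L[ℂ] H) : Antitone fun k => charValue k T := fun k l hkl => by
  refine le_of_forall_gt fun c hc => ?_
  obtain ⟨R, hR, hn⟩ := exists_rank_le_of_charValue_lt hc
  exact (charValue_le_norm_sub (hR.trans (by exact_mod_cast hkl))).trans_lt hn

theorem MemWeakSchatten.dyadicApprox {p : ℝ} {T : H →L[ℂ] H} (h : MemWeakSchatten p T) :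
    DyadicApprox ((2 : ℝ) ^ (-(1 / p))) T := by
  obtain ⟨C, hC0, hC⟩ := Asymptotics.bound_of_isBigO_nat_atTop h.2
  -- The infimum defining `charValue` need not be attained; the extra 1 makes the inequality strict.
  refine ⟨C + 1, fun j => exists_rank_le_of_charValue_lt ?_ |>.imp fun R hR => ⟨hR.1, hR.2.le⟩⟩
  have hpow : (((2 ^ j : ℕ) : ℝ)) ^ (-(1 / p)) = ((2 : ℝ) ^ (-(1 / p))) ^ j := by
    push_cast
    rw [← Real.rpow_natCast, ← Real.rpow_natCast, ← Real.rpow_mul two_pos.le,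
      ← Real.rpow_mul two_pos.le, mul_comm]
  have hpos : 0 < ((2 : ℝ) ^ (-(1 / p))) ^ j := by positivity
  have h1 := hC (x := 2 ^ j) (by rw [hpow]; exact hpos.ne')
  rw [hpow, Real.norm_of_nonneg (charValue_nonneg _ _), Real.norm_of_nonneg hpos.le] at h1
  linarith

theorem MemWeakSchatten.isCompactOperator_mul {p : ℝ} {T : H →L[ℂ] H} (h : MemWeakSchatten p T)
    (S R : H →L[ℂ] H) : IsCompactOperator (S * (T * R) : H →L[ℂ] H) :=
  (h.1.comp_clm R).clm_comp S

/-- Cauchy condensation reduces the sum to ∑ 2^j μ_{2^j}, dominated by a geometric series of ratio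
2x < 1. -/
theorem DyadicApprox.summable_charValue {x : ℝ} {T : H →L[ℂ] H} (hx : 0 < x) (hx1 : x < 1 / 2)
    (h : DyadicApprox x T) : Summable fun k => charValue k T := by
  obtain ⟨C, hC⟩ := h
  rw [← summable_condensed_iff_of_nonneg (charValue_nonneg · T)
    fun m n _ hmn => charValue_antitone T hmn]
  refine Summable.of_nonneg_of_le (fun j => mul_nonneg (by positivity) (charValue_nonneg _ _))
    (fun j => ?_)
    ((summable_geometric_of_lt_one (r := 2 * x) (by positivity) (by linarith)).mul_left C)
  obtain ⟨R, hR, hn⟩ := hC j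
  calc _ ≤ 2 ^ j * (C * x ^ j) := by gcongr; exact (charValue_le_norm_sub hR).trans hn
    _ = _ := by rw [mul_pow]; ring

/-! ### Trace properties from dyadic decay -/

variable [CompleteSpace H]

/-- The trace property for a product of a trace class operator and a bounded operator. -/
theorem DyadicApprox.exists_hasDiagSum_mul_comm {x : ℝ} {T : H →L[ℂ] H} (hx : 0 < x)
    (hx1 : x < 1 / 2) (h : DyadicApprox x T) (B : H →L[ℂ] H) :
    ∃ t, HasDiagSum (T * B) t ∧ HasDiagSum (B * T) t := by
  obtain ⟨C, S, hS, hr, hn⟩ := h.exists_hasSum hx (by linarith)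
  choose t h1 h2 h3 h4 using fun j => exists_hasDiagSum_of_rank_le (hr j) B
  have hsum : Summable fun j => ((2 ^ (j + 1) : ℕ) : ℝ) * (‖S j‖ * ‖B‖) := by
    refine Summable.of_nonneg_of_le (fun j => by positivity) (fun j => ?_)
      ((summable_geometric_of_lt_one (r := 2 * x) (by positivity) (by linarith)).mul_left
        (2 * C * ‖B‖))
    calc _ ≤ ((2 ^ (j + 1) : ℕ) : ℝ) * (C * x ^ j * ‖B‖) := by gcongr; exact hn j
      _ = _ := by push_cast; rw [mul_pow]; ring
  exact ⟨∑' j, t j, hasDiagSum_tsum (hS.mul_right B) h1 h3 hsum,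
    hasDiagSum_tsum (hS.mul_left B) h2 h4 hsum⟩

/-- The trace property `Tr (S T) = Tr (T S)` for operators of complementary decay. The parameter
`s` interpolates between the ranks of the two factors. -/
theorem DyadicApprox.exists_hasDiagSum_mul_comm' {x y s : ℝ} {S T : H →L[ℂ] H} (hx : 0 < x)
    (hx1 : x < 1) (hy : 0 < y) (hy1 : y < 1) (hs1 : 1 ≤ s) (hs2 : s ≤ 2) (hsx : s * x < 1)
    (hsy : 2 * y < s) (hS : DyadicApprox x S) (hT : DyadicApprox y T) :
    ∃ t, HasDiagSum (S * T) t ∧ HasDiagSum (T * S) t := by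
  obtain ⟨C, P, hP, hPr, hPn⟩ := hS.exists_hasSum hx hx1
  obtain ⟨C', Q, hQ, hQr, hQn⟩ := hT.exists_hasSum hy hy1
  have hs0 : 0 < s := by linarith
  have h2s : 1 ≤ 2 / s := by rwa [one_le_div hs0]
  have hsplit : ∀ j : ℕ, (2 : ℝ) ^ j = s ^ j * (2 / s) ^ j := fun j => by
    rw [← mul_pow]; congr 1; field_simp
  -- The rank estimate is applied to whichever piece has the smaller index. As s and 2/s are at
  -- least 1, 2^min(j,l) ≤ s^j (2/s)^l, which separates the variables.
  have key : ∀ p : ℕ × ℕ, ∃ t, HasDiagSum (P p.1 * Q p.2) t ∧ HasDiagSum (Q p.2 * P p.1) t ∧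
      DiagLE (P p.1 * Q p.2) (2 * (s ^ p.1 * (2 / s) ^ p.2) * (‖P p.1‖ * ‖Q p.2‖)) ∧
      DiagLE (Q p.2 * P p.1) (2 * (s ^ p.1 * (2 / s) ^ p.2) * (‖P p.1‖ * ‖Q p.2‖)) := by
    rintro ⟨j, l⟩
    rcases le_total j l with hjl | hlj
    · obtain ⟨t, h1, h2, h3, h4⟩ := exists_hasDiagSum_of_rank_le (hPr j) (Q l)
      have : ((2 ^ (j + 1) : ℕ) : ℝ) ≤ 2 * (s ^ j * (2 / s) ^ l) := by
        push_cast
        rw [pow_succ', hsplit]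
        gcongr
      exact ⟨t, h1, h2, h3.mono (by gcongr), h4.mono (by gcongr)⟩
    · obtain ⟨t, h1, h2, h3, h4⟩ := exists_hasDiagSum_of_rank_le (hQr l) (P j)
      have : ((2 ^ (l + 1) : ℕ) : ℝ) ≤ 2 * (s ^ j * (2 / s) ^ l) := by
        push_cast
        rw [pow_succ', hsplit]
        gcongr
      rw [mul_comm ‖Q l‖] at h3 h4
      exact ⟨t, h2, h1, h4.mono (by gcongr), h3.mono (by gcongr)⟩
  choose t h1 h2 h3 h4 using key
  have hC0 : 0 ≤ C := by simpa using (norm_nonneg _).trans (hPn 0)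
  have hC0' : 0 ≤ C' := by simpa using (norm_nonneg _).trans (hQn 0)
  have hsum : Summable fun p : ℕ × ℕ =>
      2 * (s ^ p.1 * (2 / s) ^ p.2) * (‖P p.1‖ * ‖Q p.2‖) := by
    have hg1 := summable_geometric_of_lt_one (r := s * x) (by positivity) hsx
    have hg2 := summable_geometric_of_lt_one (r := 2 / s * y) (by positivity)
      (by rw [div_mul_eq_mul_div, div_lt_one hs0]; exact hsy)
    refine Summable.of_nonneg_of_le (fun p => by positivity) (fun p => ?_)
      ((hg1.mul_of_nonneg hg2 (fun _ => by positivity) (fun _ => by positivity)).mul_left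
        (2 * C * C'))
    calc _ ≤ 2 * (s ^ p.1 * (2 / s) ^ p.2) * ((C * x ^ p.1) * (C' * y ^ p.2)) := by
          gcongr
          · exact hPn p.1
          · exact hQn p.2
      _ = _ := by rw [mul_pow, mul_pow]; ring
  have hPs : Summable fun j => ‖P j‖ := Summable.of_nonneg_of_le (fun _ => norm_nonneg _) hPn
    ((summable_geometric_of_lt_one hx.le hx1).mul_left _)
  have hQs : Summable fun j => ‖Q j‖ := Summable.of_nonneg_of_le (fun _ => norm_nonneg _) hQn
    ((summable_geometric_of_lt_one hy.le hy1).mul_left _)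
  have hPQ : HasSum (fun p : ℕ × ℕ => P p.1 * Q p.2) (S * T) :=
    hP.mul hQ (summable_mul_of_summable_norm hPs hQs)
  have hQP : HasSum (fun p : ℕ × ℕ => Q p.2 * P p.1) (T * S) :=
    (Equiv.prodComm ℕ ℕ).hasSum_iff.2 (hQ.mul hP (summable_mul_of_summable_norm hQs hPs))
  exact ⟨∑' p, t p, hasDiagSum_tsum hPQ h1 h3 hsum, hasDiagSum_tsum hQP h2 h4 hsum⟩

end DyadicApprox

/-! ### Twisted derivations and the Hochschild coboundary -/

section Algebra

theorem contractNth_zero_succ {B : Type*} {m : ℕ} (op : B → B → B) (a : Fin (m + 2) → B) :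
    Fin.contractNth (0 : Fin (m + 2)) op a =
      Fin.cons (op (a 0) (a 1)) fun i => a i.succ.succ := by
  ext k
  cases k using Fin.cases with
  | zero => simp [Fin.contractNth]
  | succ k => simp [Fin.contractNth]

theorem contractNth_succ_succ {B : Type*} {m : ℕ} (op : B → B → B) (j : Fin (m + 1))
    (a : Fin (m + 2) → B) :
    Fin.contractNth j.succ op a = Fin.cons (a 0) (Fin.contractNth j op fun i => a i.succ) := by
  ext k
  cases k using Fin.cases with
  | zero => simp [Fin.contractNth]
  | succ k => simp [Fin.contractNth]

/-- For multiplicative maps `π` and `α` with difference `d`, the alternating sum of the products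
`d a⁰ ⋯ d (aⁱ aⁱ⁺¹) ⋯ d aᵐ` telescopes. -/
theorem sum_prod_contractNth {B R : Type*} [Mul B] [Ring R] {π α d : B → R}
    (hπ : ∀ a b, π (a * b) = π a * π b) (hα : ∀ a b, α (a * b) = α a * α b)
    (hd : ∀ a, d a = π a - α a) (m : ℕ) (a : Fin (m + 1) → B) :
    ∑ i : Fin m, (-1) ^ (i : ℕ) *
        (List.ofFn fun k => d (Fin.contractNth i.castSucc (· * ·) a k)).prod =
      π (a 0) * (List.ofFn fun i : Fin m => d (a i.succ)).prod -
        (-1) ^ m * ((List.ofFn fun i : Fin m => d (a i.castSucc)).prod * π (a (Fin.last m))) -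
        (if Odd m then 1 else 0) * (List.ofFn fun i => d (a i)).prod := by
  induction m with
  | zero => simp
  | succ m ih =>
    -- Twisted Leibniz rule. Replacing α by π − d yields a term in π that cancels against the
    -- induction hypothesis, and a full product of d's that flips the parity term.
    have hdmul : d (a 0 * a 1) = π (a 0) * d (a 1) + d (a 0) * α (a 1) := by
      rw [hd, hd, hd, hπ, hα]; noncomm_ring
    have hα1 : α (a 1) = π (a 1) - d (a 1) := by rw [hd]; noncomm_ring
    rw [Fin.sum_univ_succ]
    have hstep : ∀ i : Fin m, (-1 : R) ^ ((i.succ : Fin (m + 1)) : ℕ) *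
        (List.ofFn fun k => d (Fin.contractNth i.succ.castSucc (· * ·) a k)).prod =
        -(d (a 0) * ((-1) ^ (i : ℕ) * (List.ofFn fun k =>
          d (Fin.contractNth i.castSucc (· * ·) (fun j => a j.succ) k)).prod)) := fun i => by
      rw [← Fin.succ_castSucc, contractNth_succ_succ, List.ofFn_succ, List.prod_cons, Fin.val_succ,
        pow_succ]
      simp only [Fin.cons_zero, Fin.cons_succ]
      rw [← mul_assoc (d (a 0)), ((Commute.neg_one_right (d (a 0))).pow_right _).eq]
      noncomm_ring
    rw [Finset.sum_congr rfl fun i _ => hstep i, Finset.sum_neg_distrib, ← Finset.mul_sum, ih]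
    simp only [Fin.castSucc_zero, contractNth_zero_succ]
    have hlast : a (Fin.last m).succ = a (Fin.last (m + 1)) := by rw [Fin.succ_last]
    have hodd : (if Odd (m + 1) then 1 else 0 : R) = 1 - if Odd m then 1 else 0 := by
      by_cases h : Odd m <;> simp [h, Nat.odd_add_one]
    have h0 : (List.ofFn fun k : Fin (m + 1) => d ((Fin.cons (a 0 * a 1) fun i => a i.succ.succ :
        Fin (m + 1) → B) k)).prod = d (a 0 * a 1) * (List.ofFn fun k : Fin m =>
          d (a k.succ.succ)).prod := by
      rw [List.ofFn_succ, List.prod_cons]; simp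
    have h1 : (List.ofFn fun i : Fin (m + 1) => d (a i.succ)).prod =
        d (a 1) * (List.ofFn fun k : Fin m => d (a k.succ.succ)).prod := by
      rw [List.ofFn_succ, List.prod_cons]; simp
    have h2 : (List.ofFn fun i : Fin (m + 1) => d (a i.castSucc)).prod =
        d (a 0) * (List.ofFn fun k : Fin m => d (a k.castSucc.succ)).prod := by
      rw [List.ofFn_succ, List.prod_cons]; simp
    have h3 : (List.ofFn fun i : Fin (m + 2) => d (a i)).prod =
        d (a 0) * (List.ofFn fun i : Fin (m + 1) => d (a i.succ)).prod := by
      rw [List.ofFn_succ, List.prod_cons]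
    rw [h0, h2, h3, h1, hlast, hodd, hdmul, hα1, Fin.succ_zero_eq_one, pow_succ]
    have hc : ∀ X : R, d (a 0) * ((-1) ^ m * X) = (-1) ^ m * (d (a 0) * X) := fun X => by
      rw [← mul_assoc, ((Commute.neg_one_right (d (a 0))).pow_right _).eq, mul_assoc]
    have hc' : ∀ X : R, d (a 0) * ((if Odd m then 1 else 0) * X) =
        (if Odd m then 1 else 0) * (d (a 0) * X) := fun X => by split_ifs <;> simp
    simp only [mul_sub, sub_mul, hc, hc', Fin.val_zero, pow_zero, one_mul, add_mul, mul_assoc]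
    noncomm_ring

end Algebra

/-! ### The twisted derivation of an invertible spectral triple -/

section Inverse

variable {H : Type*} [NormedAddCommGroup H] [InnerProductSpace ℂ H]

theorem boundedInverse_apply {D : H →ₗ.[ℂ] H} (hD : IsInvertible D) (x : D.domain) :
    boundedInverse D hD (D x) = x := by
  simpa using (boundedInverse_spec D hD).2 x

theorem apply_boundedInverse {D : H →ₗ.[ℂ] H} (hD : IsInvertible D) (y : H) :
    ∃ h : boundedInverse D hD y ∈ D.domain, D ⟨boundedInverse D hD y, h⟩ = y := by
  simpa using (boundedInverse_spec D hD).1 y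

end Inverse

section Triple

variable {A : Type*} [NonUnitalRing A] [Module ℂ A] {σ : A →ₙₐ[ℂ] A} {H : Type*}
  [NormedAddCommGroup H] [InnerProductSpace ℂ H] [CompleteSpace H]

namespace TwistedSpectralTriple

variable (𝒯 : TwistedSpectralTriple σ H) (hD : IsInvertible 𝒯.D)

theorem ext_of_domain {S T : H →L[ℂ] H} (h : ∀ x : 𝒯.D.domain, S x = T x) : S = T :=
  ContinuousLinearMap.ext_on (s := 𝒯.D.domain)
    (by simpa [Submodule.span_eq] using 𝒯.isSelfAdjoint_D.dense_domain) fun x hx => h ⟨x, hx⟩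

/-- The operator `D⁻¹ d_σ a`. -/
noncomputable def invDσ (a : A) : H →L[ℂ] H :=
  boundedInverse 𝒯.D hD * 𝒯.dσ a

/-- The bounded extension of `D⁻¹ σ(a) D`. -/
noncomputable def conjRep (a : A) : H →L[ℂ] H :=
  𝒯.rep a - 𝒯.invDσ hD a

theorem conjRep_apply (a : A) (x : 𝒯.D.domain) :
    𝒯.conjRep hD a x = boundedInverse 𝒯.D hD (𝒯.rep (σ a) (𝒯.D x)) := by
  simp [conjRep, invDσ, dσ_apply, boundedInverse_apply]

theorem invDσ_eq (a : A) : 𝒯.invDσ hD a = 𝒯.rep a - 𝒯.conjRep hD a := by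
  simp [conjRep]

/-- Formally D⁻¹σ(a)D · D⁻¹σ(b)D = D⁻¹σ(ab)D; this is legitimate on the domain because D⁻¹ takes
values there. -/
theorem conjRep_mul (a b : A) :
    𝒯.conjRep hD (a * b) = 𝒯.conjRep hD a * 𝒯.conjRep hD b := by
  refine 𝒯.ext_of_domain fun x => ?_
  obtain ⟨h, h'⟩ := apply_boundedInverse hD (𝒯.rep (σ b) (𝒯.D x))
  rw [mul_apply_eq_comp, conjRep_apply, conjRep_apply,
    𝒯.conjRep_apply hD a ⟨_, h⟩, h', map_mul, map_mul, mul_apply_eq_comp]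

theorem dσ_add (a b : A) : 𝒯.dσ (a + b) = 𝒯.dσ a + 𝒯.dσ b := by
  refine 𝒯.ext_of_domain fun x => ?_
  have : (⟨𝒯.rep (a + b) x, 𝒯.rep_mem_domain (a + b) x⟩ : 𝒯.D.domain) =
      ⟨𝒯.rep a x, 𝒯.rep_mem_domain a x⟩ + ⟨𝒯.rep b x, 𝒯.rep_mem_domain b x⟩ :=
    Subtype.ext (by simp)
  rw [add_apply, dσ_apply, dσ_apply, dσ_apply, this, LinearPMap.map_add]
  simp only [map_add, add_apply]
  abel

theorem dσ_smul (c : ℂ) (a : A) : 𝒯.dσ (c • a) = c • 𝒯.dσ a := by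
  refine 𝒯.ext_of_domain fun x => ?_
  have : (⟨𝒯.rep (c • a) x, 𝒯.rep_mem_domain (c • a) x⟩ : 𝒯.D.domain) =
      c • ⟨𝒯.rep a x, 𝒯.rep_mem_domain a x⟩ := Subtype.ext (by simp)
  rw [smul_apply, dσ_apply, dσ_apply, this, LinearPMap.map_smul]
  simp only [map_smul, smul_apply, smul_sub]

/-- The map `a ↦ D⁻¹ d_σ a` as a linear map. -/
noncomputable def invDσₗ : A →ₗ[ℂ] (H →L[ℂ] H) where
  toFun := 𝒯.invDσ hD
  map_add' a b := by simp only [invDσ, dσ_add, mul_add]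
  map_smul' c a := by simp [invDσ, dσ_smul]

end TwistedSpectralTriple

namespace GradedTwistedSpectralTriple

variable (𝒯 : GradedTwistedSpectralTriple σ H) (hD : IsInvertible 𝒯.D)

theorem γ_boundedInverse (y : H) :
    𝒯.γ (boundedInverse 𝒯.D hD y) = -boundedInverse 𝒯.D hD (𝒯.γ y) := by
  obtain ⟨h, h'⟩ := apply_boundedInverse hD y
  have h1 := boundedInverse_apply hD ⟨_, 𝒯.γ_mem_domain ⟨_, h⟩⟩
  rw [𝒯.D_γ, h', map_neg] at h1
  exact h1.symm

theorem commute_γ_rep (a : A) : Commute 𝒯.γ (𝒯.rep a) :=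
  𝒯.γ_comm_rep a

/-- The signs from passing D and D⁻¹ cancel. -/
theorem commute_γ_conjRep (a : A) : Commute 𝒯.γ (𝒯.conjRep hD a) := by
  refine 𝒯.ext_of_domain fun x => ?_
  have h := DFunLike.congr_fun (𝒯.γ_comm_rep (σ a)) (𝒯.D x)
  simp only [mul_apply_eq_comp] at h ⊢
  rw [𝒯.conjRep_apply hD a x, 𝒯.conjRep_apply hD a ⟨_, 𝒯.γ_mem_domain x⟩, 𝒯.D_γ,
    γ_boundedInverse, h, map_neg, map_neg]

theorem commute_γ_invDσ (a : A) : Commute 𝒯.γ (𝒯.invDσ hD a) := by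
  rw [TwistedSpectralTriple.invDσ_eq]
  exact (𝒯.commute_γ_rep a).sub_right (𝒯.commute_γ_conjRep hD a)

/-- The operator-valued multilinear map `(a⁰, …, aⁿ) ↦ γ D⁻¹ (d_σ a⁰) ⋯ D⁻¹ (d_σ aⁿ)`. -/
noncomputable def chernMultilinear (n : ℕ) : MultilinearMap ℂ (fun _ : Fin (n + 1) => A) (H →L[ℂ] H) :=
  (LinearMap.mulLeft ℂ 𝒯.γ).compMultilinearMap
    ((MultilinearMap.mkPiAlgebraFin ℂ (n + 1) (H →L[ℂ] H)).compLinearMap fun _ => 𝒯.invDσₗ hD)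

theorem chernMultilinear_apply {n : ℕ} (a : Fin (n + 1) → A) :
    𝒯.chernMultilinear hD n a = 𝒯.chernOperator hD a := by
  rw [chernMultilinear, LinearMap.compMultilinearMap_apply, MultilinearMap.compLinearMap_apply,
    MultilinearMap.mkPiAlgebraFin_apply]
  rfl

theorem chernOperator_eq {n : ℕ} (a : Fin (n + 1) → A) :
    𝒯.chernOperator hD a = 𝒯.γ * (List.ofFn fun i => 𝒯.invDσ hD (a i)).prod :=
  rfl

/-- The coboundary identity at the level of operators, for even `n`. -/
theorem sum_chernOperator_contractNth {n : ℕ} (hn : Even n) (a : Fin (n + 2) → A) :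
    ∑ i : Fin (n + 1), (-1 : ℂ) ^ (i : ℕ) •
        𝒯.chernOperator hD (Fin.contractNth i.castSucc (· * ·) a) =
      𝒯.γ * 𝒯.conjRep hD (a 0) * (List.ofFn fun i : Fin (n + 1) => 𝒯.invDσ hD (a i.succ)).prod +
        𝒯.γ * (List.ofFn fun i : Fin (n + 1) => 𝒯.invDσ hD (a i.castSucc)).prod *
          𝒯.rep (a (Fin.last (n + 1))) := by
  have h := congrArg (𝒯.γ * ·) (sum_prod_contractNth (π := 𝒯.rep) (fun a b => map_mul 𝒯.rep a b)
    (𝒯.conjRep_mul hD) (𝒯.invDσ_eq hD) (n + 1) a)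
  simp only [Finset.mul_sum] at h
  calc _ = _ := Finset.sum_congr rfl fun i _ => ?_
    _ = _ := h
    _ = _ := ?_
  · rw [chernOperator_eq]
    rcases Nat.even_or_odd (i : ℕ) with h | h <;> simp [h.neg_one_pow]
  -- Since n + 1 is odd, the full product survives and turns π(a⁰) into π(a⁰) − D⁻¹ d_σ a⁰ = α(a⁰).
  · rw [if_pos hn.add_one, hn.add_one.neg_one_pow, List.ofFn_succ (n := n + 1),
      List.prod_cons, 𝒯.invDσ_eq hD (a 0)]
    noncomm_ring

end GradedTwistedSpectralTriple

end Triple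

/-! ### The trace of the Chern operator -/

section ChernTrace

variable {A : Type*} [NonUnitalRing A] [Module ℂ A] {σ : A →ₙₐ[ℂ] A} {H : Type*}
  [NormedAddCommGroup H] [InnerProductSpace ℂ H] [CompleteSpace H]

theorem rpow_neg_one_div_pow {n : ℕ} (hn : 0 < n) : ((2 : ℝ) ^ (-(1 / (n : ℝ)))) ^ n = 1 / 2 := by
  have : (n : ℝ) ≠ 0 := by positivity
  rw [← Real.rpow_natCast, ← Real.rpow_mul two_pos.le, neg_mul, one_div_mul_cancel this,
    Real.rpow_neg_one, one_div]

theorem rpow_neg_one_div_lt_one {n : ℕ} (hn : 0 < n) : (2 : ℝ) ^ (-(1 / (n : ℝ))) < 1 :=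
  Real.rpow_lt_one_of_one_lt_of_neg one_lt_two (neg_lt_zero.2 (by positivity))

/-- The trace property for the borderline pairing of `x` with `x ^ n = 1 / 2`. -/
theorem DyadicApprox.exists_hasDiagSum_mul_comm_half {x : ℝ} {n : ℕ} (hn : 0 < n) (hx : 0 < x)
    (hx1 : x < 1) (hxn : x ^ n = 1 / 2) {S T : H →L[ℂ] H} (hS : DyadicApprox x S)
    (hT : DyadicApprox (x ^ n) T) : ∃ t, HasDiagSum (S * T) t ∧ HasDiagSum (T * S) t := by
  have hx2 : 1 / 2 ≤ x := hxn ▸ pow_le_of_le_one hx.le hx1.le hn.ne'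
  have hinv : 1 < x⁻¹ := (one_lt_inv₀ hx).2 hx1
  have hinv2 : x⁻¹ ≤ 2 := by simpa using inv_anti₀ (by norm_num) hx2
  have hxx : x⁻¹ * x = 1 := inv_mul_cancel₀ hx.ne'
  -- The midpoint of 1 and x⁻¹: strictly between them, s satisfies both sx < 1 and 2xⁿ = 1 < s.
  refine hS.exists_hasDiagSum_mul_comm' (s := (1 + x⁻¹) / 2) hx hx1 (by positivity)
    (by rw [hxn]; norm_num) ?_ ?_ ?_ ?_ hT
  · linarith
  · linarith
  · linarith
  · rw [hxn]; linarith

namespace GradedTwistedSpectralTriple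

variable (𝒯 : GradedTwistedSpectralTriple σ H) (hD : IsInvertible 𝒯.D)

theorem dyadicApprox_invDσ {x : ℝ} (h : DyadicApprox x (boundedInverse 𝒯.D hD)) (a : A) :
    DyadicApprox x (𝒯.invDσ hD a) :=
  h.mul_right _

theorem dyadicApprox_prod_invDσ {x : ℝ} (hx : 0 < x)
    (h : DyadicApprox x (boundedInverse 𝒯.D hD)) {m : ℕ} (a : Fin m → A) :
    DyadicApprox (x ^ m) (List.ofFn fun i => 𝒯.invDσ hD (a i)).prod :=
  DyadicApprox.prod_ofFn hx fun i => 𝒯.dyadicApprox_invDσ hD h (a i)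

theorem isTraceClass_chernOperator {n : ℕ} (hn : 0 < n)
    (hDn : MemWeakSchatten (n : ℝ) (boundedInverse 𝒯.D hD)) (a : Fin (n + 1) → A) :
    IsTraceClass (𝒯.chernOperator hD a) := by
  have hx : (0 : ℝ) < 2 ^ (-(1 / (n : ℝ))) := by positivity
  refine ⟨?_, ((𝒯.dyadicApprox_prod_invDσ hD hx hDn.dyadicApprox a).mul_left
    𝒯.γ).summable_charValue (pow_pos hx _) ?_⟩
  · rw [chernOperator_eq, List.ofFn_succ, List.prod_cons, TwistedSpectralTriple.invDσ, mul_assoc]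
    exact hDn.isCompactOperator_mul _ _
  · rw [pow_succ, rpow_neg_one_div_pow hn]
    linarith [rpow_neg_one_div_lt_one hn]

/-- Multilinearity passes from the operators to the numbers by uniqueness of diagonal sums. -/
theorem exists_multilinear_hasDiagSum {n : ℕ}
    (h : ∀ a : Fin (n + 1) → A, ∃ t, HasDiagSum (𝒯.chernOperator hD a) t) :
    ∃ Φ : Cochain A n, ∀ a, HasDiagSum (𝒯.chernOperator hD a) (Φ a) := by
  choose φ hφ using h
  refine ⟨⟨φ, fun a i x y => ?_, fun a i c x => ?_⟩, hφ⟩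
  · refine (hφ _).unique ?_
    rw [← chernMultilinear_apply, MultilinearMap.map_update_add, chernMultilinear_apply,
      chernMultilinear_apply]
    exact (hφ _).add (hφ _)
  · refine (hφ _).unique ?_
    rw [← chernMultilinear_apply, MultilinearMap.map_update_smul, chernMultilinear_apply]
    exact (hφ _).smul c

variable {n : ℕ} {x : ℝ} {Φ : Cochain A n}

/-- As γ commutes with D⁻¹ d_σ a⁰, both sides are traces of the same two factors in opposite orders,
of rates x and xⁿ = 1/2. -/
theorem cyclic_of_hasDiagSum (hn : 0 < n) (hx : 0 < x) (hx1 : x < 1) (hxn : x ^ n = 1 / 2)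
    (hDx : DyadicApprox x (boundedInverse 𝒯.D hD))
    (hΦ : ∀ a, HasDiagSum (𝒯.chernOperator hD a) (Φ a)) (a : Fin (n + 1) → A) :
    Φ (fun i => a (i + 1)) = Φ a := by
  let Q := (List.ofFn fun i : Fin n => 𝒯.invDσ hD (a i.succ)).prod
  obtain ⟨t, h1, h2⟩ := (𝒯.dyadicApprox_invDσ hD hDx (a 0)).exists_hasDiagSum_mul_comm_half hn hx
    hx1 hxn ((𝒯.dyadicApprox_prod_invDσ hD hx hDx fun i : Fin n => a i.succ).mul_left
      𝒯.γ)
  have e1 : 𝒯.chernOperator hD a = 𝒯.invDσ hD (a 0) * (𝒯.γ * Q) := by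
    rw [chernOperator_eq, List.ofFn_succ, List.prod_cons, ← mul_assoc, ← mul_assoc,
      (𝒯.commute_γ_invDσ hD (a 0)).eq]
  have e2 : 𝒯.chernOperator hD (fun i => a (i + 1)) = 𝒯.γ * Q * 𝒯.invDσ hD (a 0) := by
    rw [chernOperator_eq, List.ofFn_succ', List.concat_eq_append, List.prod_append,
      List.prod_singleton, Fin.last_add_one]
    simp only [Fin.coeSucc_eq_succ]
    rw [mul_assoc]
  exact ((hΦ _).unique (e2 ▸ h2)).trans ((hΦ _).unique (e1 ▸ h1)).symm

theorem hochschildB_eq_zero_of_hasDiagSum (hn : 0 < n) (hne : Even n) (hx : 0 < x) (hx1 : x < 1)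
    (hxn : x ^ n = 1 / 2) (hDx : DyadicApprox x (boundedInverse 𝒯.D hD))
    (hΦ : ∀ a, HasDiagSum (𝒯.chernOperator hD a) (Φ a)) (a : Fin (n + 2) → A) :
    hochschildB Φ a = 0 := by
  let l := a (Fin.last (n + 1))
  let P := (List.ofFn fun i : Fin (n + 1) => 𝒯.invDσ hD (a i.castSucc)).prod
  let Q := (List.ofFn fun i : Fin n => 𝒯.invDσ hD (a i.succ.castSucc)).prod
  have hP : DyadicApprox (x ^ (n + 1)) (𝒯.γ * P) :=
    (𝒯.dyadicApprox_prod_invDσ hD hx hDx fun i : Fin (n + 1) => a i.castSucc).mul_left _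
  have hQ : DyadicApprox (x ^ n) (𝒯.γ * 𝒯.conjRep hD (a 0) * Q) :=
    (𝒯.dyadicApprox_prod_invDσ hD hx hDx fun i : Fin n => a i.succ.castSucc).mul_left _
  -- Two trace exchanges: π(l) past n + 1 factors, of rate below 1/2, and D⁻¹ d_σ l past the
  -- remaining n, where the borderline version is needed.
  obtain ⟨t, ht1, ht2⟩ := hP.exists_hasDiagSum_mul_comm (pow_pos hx _)
    (by rw [pow_succ, hxn]; linarith) (𝒯.rep l)
  obtain ⟨u, hu1, hu2⟩ := (𝒯.dyadicApprox_invDσ hD hDx l).exists_hasDiagSum_mul_comm_half hn hx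
    hx1 hxn hQ
  have hsum : HasDiagSum (∑ i : Fin (n + 1), (-1 : ℂ) ^ (i : ℕ) •
      𝒯.chernOperator hD (Fin.contractNth i.castSucc (· * ·) a))
      (∑ i : Fin (n + 1), (-1) ^ (i : ℕ) * Φ (Fin.contractNth i.castSucc (· * ·) a)) :=
    HasDiagSum.sum _ fun i _ => (hΦ _).smul _
  have e1 : 𝒯.γ * 𝒯.conjRep hD (a 0) *
      (List.ofFn fun i : Fin (n + 1) => 𝒯.invDσ hD (a i.succ)).prod =
      𝒯.γ * 𝒯.conjRep hD (a 0) * Q * 𝒯.invDσ hD l := by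
    rw [List.ofFn_succ', List.concat_eq_append, List.prod_append, List.prod_singleton, Fin.succ_last,
      ← mul_assoc]
    rfl
  have e2 : 𝒯.chernOperator hD (Fin.cons (l * a 0) fun i : Fin n => a i.succ.castSucc) =
      𝒯.rep l * (𝒯.γ * P) + 𝒯.invDσ hD l * (𝒯.γ * 𝒯.conjRep hD (a 0) * Q) := by
    have hPQ : P = 𝒯.invDσ hD (a 0) * Q := by
      simp only [P, Q]
      rw [List.ofFn_succ, List.prod_cons, Fin.castSucc_zero]
    -- The same Leibniz rule splits the last Hochschild term into the two exchanged products.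
    have hd : 𝒯.invDσ hD (l * a 0) =
        𝒯.rep l * 𝒯.invDσ hD (a 0) + 𝒯.invDσ hD l * 𝒯.conjRep hD (a 0) := by
      simp only [TwistedSpectralTriple.invDσ_eq, TwistedSpectralTriple.conjRep_mul, map_mul]
      noncomm_ring
    rw [chernOperator_eq, List.ofFn_succ, List.prod_cons]
    simp only [Fin.cons_zero, Fin.cons_succ]
    rw [hd, hPQ, ← mul_assoc (𝒯.rep l) 𝒯.γ, ← (𝒯.commute_γ_rep l).eq, mul_assoc 𝒯.γ _ Q,
      ← mul_assoc (𝒯.invDσ hD l) 𝒯.γ, ← (𝒯.commute_γ_invDσ hD l).eq]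
    noncomm_ring
  rw [𝒯.sum_chernOperator_contractNth hD hne, e1] at hsum
  have h1 := hsum.unique (hu2.add ht1)
  have h2 := (e2 ▸ hΦ _ : HasDiagSum _ (Φ (Fin.cons (l * a 0) fun i : Fin n =>
    a i.succ.castSucc))).unique (ht2.add hu1)
  rw [hochschildB, h1, h2, hne.add_one.neg_one_pow]
  ring

end GradedTwistedSpectralTriple

end ChernTrace

end NCG

theorem mainTheorem1 {A : Type*} [NonUnitalRing A] [Module ℂ A] [IsScalarTower ℂ A A]
    [SMulCommClass ℂ A A] (σ : A →ₙₐ[ℂ] A) (hσ : Function.Bijective σ)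
    {H : Type*} [NormedAddCommGroup H] [InnerProductSpace ℂ H] [CompleteSpace H]
    (𝒯 : NCG.GradedTwistedSpectralTriple σ H) (hD : NCG.IsInvertible 𝒯.D)
    (n : ℕ) (hn : Even n) (hn0 : 0 < n)
    (hDn : NCG.MemWeakSchatten (n : ℝ) (NCG.boundedInverse 𝒯.D hD)) :
    ∃ Φ : NCG.Cochain A n, Φ ∈ NCG.cyclicCocycles A n ∧
      ∀ a : Fin (n + 1) → A, NCG.HasTrace (𝒯.chernOperator hD a) (Φ a) := by
  have hx : (0 : ℝ) < 2 ^ (-(1 / (n : ℝ))) := by positivity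
  have hx1 := NCG.rpow_neg_one_div_lt_one hn0
  have hxn := NCG.rpow_neg_one_div_pow hn0
  have hDx := hDn.dyadicApprox
  obtain ⟨Φ, hΦ⟩ := 𝒯.exists_multilinear_hasDiagSum hD (n := n) fun a => by
    obtain ⟨t, -, ht⟩ := (𝒯.dyadicApprox_prod_invDσ hD hx hDx a).exists_hasDiagSum_mul_comm
      (pow_pos hx _) (by rw [pow_succ, hxn]; linarith) 𝒯.γ
    exact ⟨t, ht⟩
  refine ⟨Φ, ⟨fun a => ?_, 𝒯.hochschildB_eq_zero_of_hasDiagSum hD hn0 hn hx hx1 hxn hDx hΦ⟩,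
    fun a => ⟨𝒯.isTraceClass_chernOperator hD hn0 hDn a, hΦ a⟩⟩
  rw [hn.neg_one_pow, one_mul]
  exact 𝒯.cyclic_of_hasDiagSum hD hn0 hx hx1 hxn hDx hΦ a
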